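/- Let $\alpha,\beta\in\mathbb{R}$ and let $\Phi_{\alpha,\beta}(\rho)=K_1\rho K_1^*+K_2\rho K_2^*$ be the map on $2\times 2$ complex matrices with Kraus operators $$K_1=\begin{pmatrix}\cos\alpha&0\\0&\cos\beta\end{pmatrix},\qquad K_2=\begin{pmatrix}0&\sin\beta\\\sin\alpha&0\end{pmatrix}.$$ Then $\Phi_{\alpha,\beta}$ is a quantum channel (a completely positive trace-preserving linear map), and the condition $|\sin(\alpha+\beta)|=|\cos(\beta-\alpha)|$ is equivalent to $\cos(2\alpha)\cos(2\beta)=0$. If this condition holds, then $\Phi_{\alpha,\beta}$ is both degradable and antidegradable. Here, for an isometry $V:\mathbb{C}^2\to\mathbb{C}^2\otimes\mathbb{C}^d$ with $\Phi(\rho)=\operatorname{tr}_{\mathbb{C}^d}(V\rho V^*)$ for all $\rho$, the map $\widetilde\Phi(\rho)=\operatorname{tr}_{\mathbb{C}^2}(V\rho V^*)$ is called a complementary channel of $\Phi$. A channel $\Phi$ is degradable if $\widetilde\Phi=\Gamma\circ\Phi$ for some complementary channel $\widetilde\Phi$ of $\Phi$ and some quantum channel $\Gamma$, and antidegradable if $\Phi=\Xi\circ\widetilde\Phi$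 for some complementary channel $\widetilde\Phi$ of $\Phi$ and some quantum channel $\Xi$. -/

import Mathlib

open scoped Matrix CStarAlgebra ComplexOrder

namespace QubitChannel

/-- A quantum channel `L(ℂⁿ) → L(ℂᵐ)`: a linear map that is completely positive (as a map between
the C⋆-algebras of complex matrices) and trace preserving. -/
def IsChannel {n m : Type} [Fintype n] [Fintype m]
    (Φ : Matrix n n ℂ →ₗ[ℂ] Matrix m m ℂ) : Prop :=
  (∃ F : CStarMatrix n n ℂ →CP CStarMatrix m m ℂ,
      ∀ X : Matrix n n ℂ, F (CStarMatrix.ofMatrix X) = CStarMatrix.ofMatrix (Φ X)) ∧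
    ∀ X : Matrix n n ℂ, (Φ X).trace = X.trace

/-- Partial trace over the second tensor factor. -/
def traceSnd {m d : Type} [Fintype d] (M : Matrix (m × d) (m × d) ℂ) : Matrix m m ℂ :=
  Matrix.of fun i j => ∑ k, M (i, k) (j, k)

/-- Partial trace over the first tensor factor. -/
def traceFst {m d : Type} [Fintype m] (M : Matrix (m × d) (m × d) ℂ) : Matrix d d ℂ :=
  Matrix.of fun k l => ∑ i, M (i, k) (i, l)

/-- `Ψ` is a complementary channel of `Φ`: for some isometry `V : ℂⁿ → ℂᵐ ⊗ ℂᵈ`, the map `Φ` is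
`ρ ↦ tr_{ℂᵈ}(V ρ V*)` and `Ψ` is `ρ ↦ tr_{ℂᵐ}(V ρ V*)`. -/
def IsComplementary {n m d : Type} [Fintype n] [DecidableEq n] [Fintype m] [Fintype d]
    (Φ : Matrix n n ℂ →ₗ[ℂ] Matrix m m ℂ) (Ψ : Matrix n n ℂ →ₗ[ℂ] Matrix d d ℂ) : Prop :=
  ∃ V : Matrix (m × d) n ℂ, Vᴴ * V = 1 ∧
    (∀ ρ, Φ ρ = traceSnd (V * ρ * Vᴴ)) ∧ ∀ ρ, Ψ ρ = traceFst (V * ρ * Vᴴ)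

/-- `Φ` is degradable: its complementary channel is `Γ ∘ Φ` for some channel `Γ`. The complementary
channel is unique up to an isometric change of environment, so the condition does not depend on
which one is taken. -/
def IsDegradable {n m : Type} [Fintype n] [DecidableEq n] [Fintype m]
    (Φ : Matrix n n ℂ →ₗ[ℂ] Matrix m m ℂ) : Prop :=
  ∃ (d : ℕ) (Ψ : Matrix n n ℂ →ₗ[ℂ] Matrix (Fin d) (Fin d) ℂ), IsComplementary Φ Ψ ∧
    ∃ Γ : Matrix m m ℂ →ₗ[ℂ] Matrix (Fin d) (Fin d) ℂ, IsChannel Γ ∧ Ψ = Γ ∘ₗ Φ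

/-- `Φ` is antidegradable: it is `Ξ ∘ Ψ` with `Ψ` its complementary channel and `Ξ` some
channel. -/
def IsAntidegradable {n m : Type} [Fintype n] [DecidableEq n] [Fintype m]
    (Φ : Matrix n n ℂ →ₗ[ℂ] Matrix m m ℂ) : Prop :=
  ∃ (d : ℕ) (Ψ : Matrix n n ℂ →ₗ[ℂ] Matrix (Fin d) (Fin d) ℂ), IsComplementary Φ Ψ ∧
    ∃ Ξ : Matrix (Fin d) (Fin d) ℂ →ₗ[ℂ] Matrix m m ℂ, IsChannel Ξ ∧ Φ = Ξ ∘ₗ Ψ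

/-- The first Kraus operator. -/
noncomputable def K₁ (α β : ℝ) : Matrix (Fin 2) (Fin 2) ℂ :=
  !![(Real.cos α : ℂ), 0; 0, (Real.cos β : ℂ)]

/-- The second Kraus operator. -/
noncomputable def K₂ (α β : ℝ) : Matrix (Fin 2) (Fin 2) ℂ :=
  !![0, (Real.sin β : ℂ); (Real.sin α : ℂ), 0]

/-- The qubit map with Kraus operators `K₁, K₂`: `ρ ↦ K₁ ρ K₁* + K₂ ρ K₂*`. -/
noncomputable def qubitChannel (α β : ℝ) :
    Matrix (Fin 2) (Fin 2) ℂ →ₗ[ℂ] Matrix (Fin 2) (Fin 2) ℂ where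
  toFun ρ := K₁ α β * ρ * (K₁ α β)ᴴ + K₂ α β * ρ * (K₂ α β)ᴴ
  map_add' ρ σ := by
    simp only [Matrix.mul_add, Matrix.add_mul]
    abel
  map_smul' c ρ := by
    simp only [Matrix.mul_smul, Matrix.smul_mul, smul_add, RingHom.id_apply]

end QubitChannel

open scoped CStarAlgebra ComplexOrder Matrix

/-! The isometry stacking `K₁` over `K₂` turns the rows of the Kraus operators into the Kraus
operators of the complementary channel. Here they again have the shape of `K₁` and `K₂`, with `β`
replaced by `π/2 - β`. When `cos 2α * cos 2β = 0`, one of the angles has `sin = ± cos`, so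
exchanging `sin β` and `cos β` changes the output only by a unitary conjugation. A unitary
conjugation is a channel with a channel inverse, which gives both properties at once. -/

/-- In a C⋆-algebra, any finite sum of maps `x ↦ a * x * star a` is completely positive. -/
noncomputable def CompletelyPositiveMap.sumConj {A ι : Type*} [NonUnitalCStarAlgebra A]
    [PartialOrder A] [StarOrderedRing A] [Fintype ι] (a : ι → A) : A →CP A where
  toFun x := ∑ i, a i * x * star (a i)
  map_add' x y := by simp only [mul_add, add_mul, Finset.sum_add_distrib]
  map_smul' c x := by
    simp only [mul_smul_comm, smul_mul_assoc, Finset.smul_sum, RingHom.id_apply]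
  map_cstarMatrix_nonneg' k M hM := by
    -- The `k`-fold amplification of conjugation by `a i` is conjugation by the diagonal matrix with
    -- constant entry `a i`, which preserves positivity.
    let D (i : ι) : CStarMatrix (Fin k) (Fin k) A :=
      CStarMatrix.ofMatrix (Matrix.diagonal fun _ => a i)
    have h : 0 ≤ ∑ i, D i * M * star (D i) :=
      Finset.sum_nonneg fun i _ => star_right_conjugate_nonneg hM (D i)
    convert h using 1
    have hD (i : ι) (p q : Fin k) : (D i * M * star (D i)) p q = a i * M p q * star (a i) := by
      let D' : Matrix (Fin k) (Fin k) A := Matrix.diagonal fun _ => a i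
      let M' : Matrix (Fin k) (Fin k) A := CStarMatrix.ofMatrix.symm M
      change (D' * M' * D'ᴴ) p q = _
      rw [Matrix.diagonal_conjTranspose, Matrix.mul_diagonal, Matrix.diagonal_mul]
      rfl
    have hsum (s : Finset ι) (p q : Fin k) :
        (∑ i ∈ s, D i * M * star (D i)) p q = ∑ i ∈ s, a i * M p q * star (a i) := by
      rw [← Finset.sum_congr rfl fun i _ => hD i p q]
      exact Matrix.sum_apply p q s _
    exact CStarMatrix.ext fun p q => (hsum Finset.univ p q).symm

namespace QubitChannel

/-- A linear map with Kraus operators `K i` satisfying `∑ i, (K i)ᴴ * K i = 1` is a channel. -/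
theorem IsChannel.of_kraus {n ι : Type} [Fintype n] [DecidableEq n] [Fintype ι]
    {Φ : Matrix n n ℂ →ₗ[ℂ] Matrix n n ℂ} (K : ι → Matrix n n ℂ)
    (hΦ : ∀ X, Φ X = ∑ i, K i * X * (K i)ᴴ) (hK : ∑ i, (K i)ᴴ * K i = 1) : IsChannel Φ := by
  refine ⟨⟨CompletelyPositiveMap.sumConj fun i => CStarMatrix.ofMatrix (K i), fun X => ?_⟩,
    fun X => ?_⟩
  · rw [hΦ]
    rfl
  · calc (Φ X).trace = ((∑ i, (K i)ᴴ * K i) * X).trace := by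
          rw [hΦ, Finset.sum_mul, Matrix.trace_sum, Matrix.trace_sum]
          exact Finset.sum_congr rfl fun i _ => by rw [Matrix.trace_mul_comm, Matrix.mul_assoc]
      _ = X.trace := by rw [hK, one_mul]

/-- Conjugation by a matrix `U`, as a linear map. -/
def conj {n : Type} [Fintype n] (U : Matrix n n ℂ) : Matrix n n ℂ →ₗ[ℂ] Matrix n n ℂ :=
  LinearMap.mulRight ℂ Uᴴ ∘ₗ LinearMap.mulLeft ℂ U

@[simp]
theorem conj_apply {n : Type} [Fintype n] (U X : Matrix n n ℂ) : conj U X = U * X * Uᴴ := rfl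

theorem isChannel_conj {n : Type} [Fintype n] [DecidableEq n] {U : Matrix n n ℂ}
    (hU : Uᴴ * U = 1) : IsChannel (conj U) :=
  .of_kraus (fun _ : Unit => U) (fun X => by simp) (by simpa using hU)

/-- If a complementary channel of `Φ` is a unitary conjugate of `Φ`, then `Φ` is both degradable
and antidegradable. -/
theorem IsComplementary.isDegradable_and_isAntidegradable {n : Type} [Fintype n] [DecidableEq n]
    {d : ℕ} {Φ Ψ : Matrix n n ℂ →ₗ[ℂ] Matrix (Fin d) (Fin d) ℂ} (h : IsComplementary Φ Ψ)
    {U : Matrix (Fin d) (Fin d) ℂ} (hU : Uᴴ * U = 1) (hΨ : ∀ ρ, Ψ ρ = U * Φ ρ * Uᴴ) :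
    IsDegradable Φ ∧ IsAntidegradable Φ := by
  refine ⟨⟨d, Ψ, h, conj U, isChannel_conj hU, LinearMap.ext hΨ⟩,
    ⟨d, Ψ, h, conj Uᴴ, isChannel_conj ?_, LinearMap.ext fun ρ => ?_⟩⟩
  · simpa using mul_eq_one_comm.mp hU
  · rw [LinearMap.comp_apply, conj_apply, hΨ, Matrix.conjTranspose_conjTranspose,
      Matrix.mul_assoc, Matrix.mul_assoc _ Uᴴ U, hU, mul_one, ← Matrix.mul_assoc, hU, one_mul]

theorem cos_sq_add_sin_sq_ofReal (x : ℝ) :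
    (Real.cos x : ℂ) * Real.cos x + Real.sin x * Real.sin x = 1 := by
  exact_mod_cast (by nlinarith [Real.sin_sq_add_cos_sq x] :
    Real.cos x * Real.cos x + Real.sin x * Real.sin x = 1)

theorem kraus_conjTranspose_mul_self (α β : ℝ) :
    (K₁ α β)ᴴ * K₁ α β + (K₂ α β)ᴴ * K₂ α β = 1 := by
  ext i j
  fin_cases i <;> fin_cases j <;>
    simp [K₁, K₂, Matrix.mul_apply, Fin.sum_univ_two, -Complex.ofReal_cos, -Complex.ofReal_sin,
      cos_sq_add_sin_sq_ofReal]

theorem isChannel_qubitChannel (α β : ℝ) : IsChannel (qubitChannel α β) :=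
  .of_kraus ![K₁ α β, K₂ α β] (fun X => by simp [qubitChannel, Fin.sum_univ_two])
    (by simpa [Fin.sum_univ_two] using kraus_conjTranspose_mul_self α β)

/-- Exchanging sine and cosine of `β` gives the complementary channel. -/
theorem isComplementary_qubitChannel (α β : ℝ) :
    IsComplementary (qubitChannel α β) (qubitChannel α (Real.pi / 2 - β)) := by
  -- The environment index `p.2` selects the Kraus operator, so tracing out `p.1` makes the `i`-th
  -- rows of `K₁` and `K₂` the rows of the `i`-th complementary Kraus operator.
  refine ⟨Matrix.of fun p j => (![K₁ α β, K₂ α β] p.2) p.1 j, ?_, fun ρ => ?_, fun ρ => ?_⟩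
  · rw [← kraus_conjTranspose_mul_self α β]
    ext i j
    simp [Matrix.mul_apply, Fintype.sum_prod_type, Fin.sum_univ_two]
    ring
  · ext i j
    simp [traceSnd, qubitChannel, Matrix.mul_apply, Fin.sum_univ_two]
  · ext i j
    simp only [traceFst, qubitChannel, LinearMap.coe_mk, AddHom.coe_mk, Matrix.add_apply,
      Matrix.of_apply, Matrix.mul_apply, Matrix.conjTranspose_apply]
    fin_cases i <;> fin_cases j <;> simp [K₁, K₂, Fin.sum_univ_two,
      Real.cos_pi_div_two_sub, Real.sin_pi_div_two_sub, -Complex.ofReal_cos, -Complex.ofReal_sin]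

theorem qubitChannel_apply (α β : ℝ) (ρ : Matrix (Fin 2) (Fin 2) ℂ) :
    qubitChannel α β ρ =
      !![(Real.cos α : ℂ) ^ 2 * ρ 0 0 + (Real.sin β : ℂ) ^ 2 * ρ 1 1,
          Real.cos α * Real.cos β * ρ 0 1 + Real.sin α * Real.sin β * ρ 1 0;
        Real.cos α * Real.cos β * ρ 1 0 + Real.sin α * Real.sin β * ρ 0 1,
          (Real.cos β : ℂ) ^ 2 * ρ 1 1 + (Real.sin α : ℂ) ^ 2 * ρ 0 0] := by
  ext i j
  simp only [qubitChannel, LinearMap.coe_mk, AddHom.coe_mk, Matrix.add_apply, Matrix.mul_apply,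
    Matrix.conjTranspose_apply]
  fin_cases i <;> fin_cases j <;>
    simp [K₁, K₂, Fin.sum_univ_two, -Complex.ofReal_cos, -Complex.ofReal_sin] <;> ring

/-- Squaring removes the absolute values, and the difference of the two squares factors into the
double-angle cosines. -/
theorem abs_sin_add_eq_abs_cos_sub_iff (α β : ℝ) :
    |Real.sin (α + β)| = |Real.cos (β - α)| ↔ Real.cos (2 * α) * Real.cos (2 * β) = 0 := by
  have h : Real.cos (2 * α) * Real.cos (2 * β) =
      Real.cos (β - α) ^ 2 - Real.sin (α + β) ^ 2 := by
    rw [Real.cos_two_mul', Real.cos_two_mul', Real.cos_sub, Real.sin_add]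
    ring
  rw [← sq_eq_sq_iff_abs_eq_abs, h, sub_eq_zero, eq_comm]

theorem sin_eq_or_eq_neg_cos_of_cos_two_mul_eq_zero {x : ℝ} (h : Real.cos (2 * x) = 0) :
    Real.sin x = Real.cos x ∨ Real.sin x = -Real.cos x := by
  rw [Real.cos_two_mul'] at h
  exact sq_eq_sq_iff_eq_or_eq_neg.mp (by linarith)

/-- If `sin α = ± cos α`, exchanging `sin β` and `cos β` swaps the two diagonal output entries, so
`U` is a bit flip. If `sin β = ± cos β`, the diagonal is unchanged and `U` is diagonal. In both
cases a minus sign requires a relative sign in `U` to correct the off-diagonal entries. -/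
theorem exists_unitary_conj_qubitChannel {α β : ℝ}
    (h : Real.cos (2 * α) * Real.cos (2 * β) = 0) :
    ∃ U : Matrix (Fin 2) (Fin 2) ℂ, Uᴴ * U = 1 ∧
      ∀ ρ, qubitChannel α (Real.pi / 2 - β) ρ = U * qubitChannel α β ρ * Uᴴ := by
  simp only [qubitChannel_apply, Real.cos_pi_div_two_sub, Real.sin_pi_div_two_sub]
  rcases mul_eq_zero.mp h with h | h <;>
    rcases sin_eq_or_eq_neg_cos_of_cos_two_mul_eq_zero h with h | h
  · refine ⟨!![0, 1; 1, 0], ?_, fun ρ => ?_⟩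
    · ext i j
      rw [Matrix.mul_apply]
      fin_cases i <;> fin_cases j <;> simp
    · ext i j
      simp only [Matrix.mul_apply, Matrix.conjTranspose_apply]
      fin_cases i <;> fin_cases j <;>
        simp [h, -Complex.ofReal_cos, -Complex.ofReal_sin] <;> ring
  · refine ⟨!![0, 1; -1, 0], ?_, fun ρ => ?_⟩
    · ext i j
      rw [Matrix.mul_apply]
      fin_cases i <;> fin_cases j <;> simp
    · ext i j
      simp only [Matrix.mul_apply, Matrix.conjTranspose_apply]
      fin_cases i <;> fin_cases j <;>
        simp [h, -Complex.ofReal_cos, -Complex.ofReal_sin] <;> ring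
  · refine ⟨1, by simp, fun ρ => ?_⟩
    simp [h, -Complex.ofReal_cos, -Complex.ofReal_sin]
  · refine ⟨!![1, 0; 0, -1], ?_, fun ρ => ?_⟩
    · ext i j
      rw [Matrix.mul_apply]
      fin_cases i <;> fin_cases j <;> simp
    · ext i j
      simp only [Matrix.mul_apply, Matrix.conjTranspose_apply]
      fin_cases i <;> fin_cases j <;>
        simp [h, -Complex.ofReal_cos, -Complex.ofReal_sin] <;> ring

end QubitChannel

theorem mainTheorem10 (α β : ℝ) :
    QubitChannel.IsChannel (QubitChannel.qubitChannel α β) ∧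
    (|Real.sin (α + β)| = |Real.cos (β - α)| ↔ Real.cos (2 * α) * Real.cos (2 * β) = 0) ∧
    (|Real.sin (α + β)| = |Real.cos (β - α)| →
      QubitChannel.IsDegradable (QubitChannel.qubitChannel α β) ∧
      QubitChannel.IsAntidegradable (QubitChannel.qubitChannel α β)) := by
  refine ⟨QubitChannel.isChannel_qubitChannel α β,
    QubitChannel.abs_sin_add_eq_abs_cos_sub_iff α β, fun h => ?_⟩
  obtain ⟨U, hU, hΨ⟩ := QubitChannel.exists_unitary_conj_qubitChannel
    ((QubitChannel.abs_sin_add_eq_abs_cos_sub_iff α β).mp h)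
  exact (QubitChannel.isComplementary_qubitChannel α β).isDegradable_and_isAntidegradable hU hΨ
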